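/- **Setting.** For $N\in\mathbb N$ and $0<W<\frac12$ let $T_N$ be the operator on discrete-time signals $x:\mathbb Z\to\mathbb C$ that sets all entries outside $\{0,\dots,N-1\}$ to zero, and let $B_W$ be the operator that restricts the discrete-time Fourier transform $X(f)=\sum_n x[n]e^{-j2\pi fn}$ to $|f|\le W$. The discrete prolate spheroidal sequences (DPSS's) are real sequences $s^{(0)}_{N,W},\dots,s^{(N-1)}_{N,W}$ on $\mathbb Z$ which, with eigenvalues $1>\lambda^{(0)}_{N,W}>\dots>\lambda^{(N-1)}_{N,W}>0$, satisfy $B_W T_N s^{(\ell)}_{N,W}=\lambda^{(\ell)}_{N,W}s^{(\ell)}_{N,W}$ and $\|T_N s^{(\ell)}_{N,W}\|_2=1$. Let $S_{N,W}$ be the $N\times N$ matrix with entries $S_{N,W}[n,\ell]=s^{(\ell)}_{N,W}[n]$, $0\le n,\ell\le N-1$, let $E_f$ be the diagonal matrix with entries $e^{j2\pi fm}$, $0\le m\le N-1$, and let $[\,\cdot\,]_k$ denote the first $k$ columns of a matrix. Let $B_{\mathrm{nyq}},B_{\mathrm{band}}>0$ be such that $J=B_{\mathrm{nyq}}/B_{\mathrm{band}}$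 is an integer, let $0<T_s\le 1/B_{\mathrm{nyq}}$, let $W=B_{\mathrm{band}}T_s/2$ and suppose that $W<\frac12$. For $i=0,\dots,J-1$ put $f_i=\bigl(-\tfrac{B_{\mathrm{nyq}}}2+(i+\tfrac12)B_{\mathrm{band}}\bigr)T_s$. The multiband modulated DPSS dictionary is the $N\times kJ$ matrix $\Psi=[\Psi_0\ \Psi_1\cdots\Psi_{J-1}]$ with $\Psi_i=[E_{f_i}S_{N,W}]_k$. For $\delta\in(0,1)$, an $M\times N$ matrix $A$ satisfies the $\Psi$-RIP of order $S$ with constant $\delta$ if $\sqrt{1-\delta}\,\|\Psi\alpha\|_2\le\|A\Psi\alpha\|_2\le\sqrt{1+\delta}\,\|\Psi\alpha\|_2$ for all $\alpha\in\mathbb C^{kJ}$ with at most $S$ nonzero entries, and $A\Psi$ satisfies the RIP of order $S$ with constant $\delta$ if $\sqrt{1-\delta}\,\|\alpha\|_2\le\|A\Psi\alpha\|_2\le\sqrt{1+\delta}\,\|\alpha\|_2$ for all such $\alpha$. The $\Psi$-block-RIP and the block-RIP of order $K$ are defined in the same way, with the bounds required for all $K$-block-sparse $\alpha=(\alpha_0,\dots,\alpha_{J-1})$,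 $\alpha_i\in\mathbb C^k$, i.e. those for which there is a set $I\subseteq\{0,\dots,J-1\}$ with $|I|=K$ and $\alpha_i=0$ for all $i\notin I$. For $0<W<\frac12$ and $0<\epsilon<1$, we say that $C_1,C_2>0$ and $N_0\in\mathbb N$ are *admissible* for $(W,\epsilon)$ if $$\lambda^{(\ell)}_{N,W}\ge 1-C_1e^{-C_2N}\quad\text{for all } N\ge N_0 \text{ and all } \ell\in\{0,\dots,N-1\}\text{ with }\ell\le 2NW(1-\epsilon).$$ **Theorem.** (0) There is an absolute constant $C_1>0$ such that for all $W\in(0,\frac12)$ and $\epsilon\in(0,1)$ there are $C_2>0$ and $N_0$, depending on $W$ and $\epsilon$, such that $C_1,C_2,N_0$ are admissible for $(W,\epsilon)$. Now let $\epsilon\in(0,1)$, let $C_1,C_2,N_0$ be any constants that are admissible for $(W,\epsilon)$, let $N\ge N_0$, suppose that $k=2NW(1-\epsilon)$ is an integer (so that $k\le N$), let $\Psi$ be the multiband modulated DPSS dictionary, and let $A\in\mathbb C^{M\times N}$. Put $\delta'=\delta+6NC_1^{1/2}e^{-C_2N/2}$. (1) If $A$ satisfies the $\Psi$-RIP of order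 $S$ with constant $\delta\in(0,1)$, then $\sqrt{1-\delta'}\,\|\alpha\|_2\le\|A\Psi\alpha\|_2\le\sqrt{1+\delta'}\,\|\alpha\|_2$ for all $\alpha\in\mathbb C^{kJ}$ with at most $S$ nonzero entries (the lower bound being read as $0$ if $\delta'>1$); that is, if $\delta'<1$, then $A\Psi$ satisfies the RIP of order $S$ with constant $\delta'$. (2) If $A$ satisfies the $\Psi$-block-RIP of order $K$ with constant $\delta\in(0,1)$, then the same two bounds hold for all $K$-block-sparse $\alpha$; that is, if $\delta'<1$, then $A\Psi$ satisfies the block-RIP of order $K$ with constant $\delta'$. -/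

import Mathlib

open scoped BigOperators

noncomputable section

/-! ### Discrete-time signals and discrete prolate spheroidal sequences -/

/-- The discrete-time Fourier transform `X(f) = ∑ₙ x[n] e^{-j 2π f n}`. It is applied below to
finitely supported signals only, for which the sum is finite. -/
def dtft (x : ℤ → ℂ) (f : ℝ) : ℂ :=
  ∑' n : ℤ, x n * Complex.exp (-(2 * Real.pi * f * n * Complex.I))

/-- The time-limiting operator `T_N`: all entries outside `{0, …, N-1}` are set to zero. -/
def timeLimit (N : ℕ) (x : ℤ → ℂ) : ℤ → ℂ :=
  fun n => if 0 ≤ n ∧ n < (N : ℤ) then x n else 0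

/-- The band-limiting operator `B_W`: the inverse transform of the DTFT of `x` cut off to the
frequency range `|f| ≤ W`. -/
def bandLimit (W : ℝ) (x : ℤ → ℂ) : ℤ → ℂ :=
  fun n => ∫ f in (-W)..W, dtft x f * Complex.exp (2 * Real.pi * f * n * Complex.I)

/-- The `ℓ²` norm of a (finite-energy) discrete-time signal. -/
def signalNorm (x : ℤ → ℂ) : ℝ :=
  Real.sqrt (∑' n : ℤ, ‖x n‖ ^ 2)

/-- `s⁽⁰⁾, …, s⁽ᴺ⁻¹⁾` are the discrete prolate spheroidal sequences for the parameters `N` and `W`,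
and `lam⁽⁰⁾, …, lam⁽ᴺ⁻¹⁾` are the corresponding eigenvalues. (The sequences are determined up to
their signs.) -/
structure IsDPSS (N : ℕ) (W : ℝ) (s : Fin N → ℤ → ℝ) (lam : Fin N → ℝ) : Prop where
  lam_lt_one : ∀ l, lam l < 1
  lam_strictAnti : ∀ l l', l < l' → lam l' < lam l
  lam_pos : ∀ l, 0 < lam l
  eigen : ∀ l, bandLimit W (timeLimit N (fun n => (s l n : ℂ))) =
    fun n => (lam l : ℂ) * (s l n : ℂ)
  normalized : ∀ l, signalNorm (timeLimit N (fun n => (s l n : ℂ))) = 1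

/-- `C₁`, `C₂` and `N₀` are positive constants, respectively an integer, for which the first DPSS
eigenvalues cluster near one:
`lam⁽ˡ⁾ ≥ 1 - C₁ e^{-C₂ N}` for all `l ≤ 2 N W (1 - ε)` and all `N ≥ N₀`. -/
def ClusterNearOne (W ε C₁ C₂ : ℝ) (N₀ : ℕ) : Prop :=
  0 < C₁ ∧ 0 < C₂ ∧
    ∀ N : ℕ, N₀ ≤ N → ∀ (s : Fin N → ℤ → ℝ) (lam : Fin N → ℝ), IsDPSS N W s lam →
      ∀ l : Fin N, ((l : ℕ) : ℝ) ≤ 2 * N * W * (1 - ε) →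
        1 - C₁ * Real.exp (-(C₂ * N)) ≤ lam l

/-! ### The multiband modulated DPSS dictionary -/

/-- The `N × N` matrix whose columns are the DPSS vectors, that is, the restrictions of the
sequences to the index range `{0, …, N-1}`. -/
def dpssMatrix {N : ℕ} (s : Fin N → ℤ → ℝ) : Matrix (Fin N) (Fin N) ℂ :=
  Matrix.of fun n l => ((s l ((n : ℕ) : ℤ) : ℝ) : ℂ)

/-- The diagonal matrix that modulates a vector by the (digital) frequency `f`. -/
def modulator (N : ℕ) (f : ℝ) : Matrix (Fin N) (Fin N) ℂ :=
  Matrix.diagonal fun m => Complex.exp (2 * Real.pi * f * ((m : ℕ) : ℂ) * Complex.I)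

/-- The midpoint `F_i` of the `i`-th band of width `Bband` in `[-Bnyq/2, Bnyq/2]`. -/
def bandCenter (Bnyq Bband : ℝ) (i : ℕ) : ℝ :=
  -(Bnyq / 2) + ((i : ℝ) + 1 / 2) * Bband

/-- The block `[E_f S]_k`: the first `k` DPSS vectors, modulated by `f`. -/
def dpssBlock {N k : ℕ} (hk : k ≤ N) (s : Fin N → ℤ → ℝ) (f : ℝ) : Matrix (Fin N) (Fin k) ℂ :=
  (modulator N f * dpssMatrix s).submatrix id (Fin.castLE hk)

/-- The multiband modulated DPSS dictionary `[Ψ₀ Ψ₁ ⋯ Ψ_{J-1}]`, the concatenation of the blocks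
`Ψ_i = [E_{f_i} S]_k` with `f_i = F_i Ts`. Its `k J` columns are indexed by pairs
(block, column in that block). -/
def dpssDictionary {N k : ℕ} (hk : k ≤ N) (Bnyq Bband Ts : ℝ) (J : ℕ) (s : Fin N → ℤ → ℝ) :
    Matrix (Fin N) (Fin J × Fin k) ℂ :=
  Matrix.of fun n p => dpssBlock hk s (bandCenter Bnyq Bband (p.1 : ℕ) * Ts) n p.2

/-! ### Restricted isometry properties -/

/-- The Euclidean norm of a complex vector. -/
def l2norm {ι : Type*} [Fintype ι] (v : ι → ℂ) : ℝ :=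
  ‖(WithLp.toLp 2 v : EuclideanSpace ℂ ι)‖

/-- `α` has at most `S` nonzero entries. -/
def IsSparse {ι : Type*} (S : ℕ) (α : ι → ℂ) : Prop :=
  {i | α i ≠ 0}.ncard ≤ S

/-- `α`, split into `J` blocks of length `k`, vanishes outside some `K` of its blocks. -/
def IsBlockSparse {J k : ℕ} (K : ℕ) (α : Fin J × Fin k → ℂ) : Prop :=
  ∃ I : Finset (Fin J), I.card = K ∧ ∀ i, i ∉ I → ∀ c, α (i, c) = 0

/-- The two-sided bound `√(1-δ) ‖α‖ ≤ ‖Φ α‖ ≤ √(1+δ) ‖α‖` for all `α` in a class `P`. -/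
def IsometryBounds {m ι : Type*} [Fintype m] [Fintype ι] (P : (ι → ℂ) → Prop)
    (Φ : Matrix m ι ℂ) (δ : ℝ) : Prop :=
  ∀ α : ι → ℂ, P α →
    Real.sqrt (1 - δ) * l2norm α ≤ l2norm (Φ.mulVec α) ∧
      l2norm (Φ.mulVec α) ≤ Real.sqrt (1 + δ) * l2norm α

/-- The two-sided bound `√(1-δ) ‖Ψ α‖ ≤ ‖A Ψ α‖ ≤ √(1+δ) ‖Ψ α‖` for all `α` in a class `P`. -/
def DictIsometryBounds {m n ι : Type*} [Fintype m] [Fintype n] [Fintype ι] (P : (ι → ℂ) → Prop)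
    (Ψ : Matrix n ι ℂ) (A : Matrix m n ℂ) (δ : ℝ) : Prop :=
  ∀ α : ι → ℂ, P α →
    Real.sqrt (1 - δ) * l2norm (Ψ.mulVec α) ≤ l2norm ((A * Ψ).mulVec α) ∧
      l2norm ((A * Ψ).mulVec α) ≤ Real.sqrt (1 + δ) * l2norm (Ψ.mulVec α)

/-- `Φ` satisfies the RIP of order `S` with constant `δ ∈ (0,1)`. -/
def RIP {m ι : Type*} [Fintype m] [Fintype ι] (Φ : Matrix m ι ℂ) (S : ℕ) (δ : ℝ) : Prop :=
  0 < δ ∧ δ < 1 ∧ IsometryBounds (IsSparse S) Φ δ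

/-- `A` satisfies the `Ψ`-RIP of order `S` with constant `δ ∈ (0,1)`. -/
def DictRIP {m n ι : Type*} [Fintype m] [Fintype n] [Fintype ι]
    (Ψ : Matrix n ι ℂ) (A : Matrix m n ℂ) (S : ℕ) (δ : ℝ) : Prop :=
  0 < δ ∧ δ < 1 ∧ DictIsometryBounds (IsSparse S) Ψ A δ

/-- `Φ` satisfies the block-RIP of order `K` with constant `δ ∈ (0,1)`. -/
def BlockRIP {m : Type*} [Fintype m] {J k : ℕ} (Φ : Matrix m (Fin J × Fin k) ℂ)
    (K : ℕ) (δ : ℝ) : Prop :=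
  0 < δ ∧ δ < 1 ∧ IsometryBounds (IsBlockSparse K) Φ δ

/-- `A` satisfies the `Ψ`-block-RIP of order `K` with constant `δ ∈ (0,1)`. -/
def DictBlockRIP {m n : Type*} [Fintype m] [Fintype n] {J k : ℕ}
    (Ψ : Matrix n (Fin J × Fin k) ℂ) (A : Matrix m n ℂ) (K : ℕ) (δ : ℝ) : Prop :=
  0 < δ ∧ δ < 1 ∧ DictIsometryBounds (IsBlockSparse K) Ψ A δ

end

/-! The Gram matrix of the dictionary is almost the identity, so `Ψ` is almost an isometry on all
coefficient vectors, sparse or not, and any `Ψ`-isometry bound for `A` passes to `A * Ψ` with a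
small loss.

Within one block the modulation cancels and the columns are exactly orthonormal, since the DPSS
vectors diagonalize the Hermitian form of energy in `[-W, W]` with distinct eigenvalues. Columns of
different blocks live on disjoint bands inside `[-1/2, 1/2]`, each with a fraction `≥ 1 - η` of its
energy in its band, where `η = C₁ e^{-C₂ N}`; by Parseval and Cauchy–Schwarz their inner product is
at most `2√η` (`norm_dotProduct_star_le_of_bands`). As there are `k J ≤ N` columns, the relative
error in `‖Ψ α‖²` is at most `κ = 2N√η` (`abs_l2norm_mulVec_sq_sub_le`), and `δ + 2κ ≤ δ'`.

Clustering of the eigenvalues is proved by Courant–Fischer (`le_lam_of_subspace`). The test space is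
spanned by `l + 1` modulated copies of one filter, a Dirichlet kernel times a power of the two-point
average. The zeros of the Dirichlet kernel make the coefficients readable from samples of the
transform, hence bounded by the energy; the other factor makes the out-of-band energy exponentially
small. -/

/-! ### Fourier analysis of finite vectors and Parseval's identity. -/

/-- The discrete-time Fourier transform of a vector `v`, regarded as a signal on `{0, …, N-1}`. -/
noncomputable def vecDtft {N : ℕ} (v : Fin N → ℂ) (f : ℝ) : ℂ :=
  ∑ n : Fin N, v n * Complex.exp (-(2 * Real.pi * f * ((n : ℕ) : ℂ) * Complex.I))

theorem tsum_timeLimit {N : ℕ} {β : Type*} [AddCommMonoid β] [TopologicalSpace β]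
    (x : ℤ → ℂ) (φ : ℤ → ℂ → β) (hφ : ∀ n, φ n 0 = 0) :
    ∑' n : ℤ, φ n (timeLimit N x n) = ∑ n : Fin N, φ ((n : ℕ) : ℤ) (x ((n : ℕ) : ℤ)) := by
  have hinj : Function.Injective (fun n : Fin N => ((n : ℕ) : ℤ)) := by
    intro a b h
    exact Fin.ext (by simpa using h)
  rw [← hinj.tsum_eq, tsum_fintype]
  · refine Finset.sum_congr rfl fun n _ => ?_
    simp [timeLimit]
  · intro n hn
    by_cases h : 0 ≤ n ∧ n < (N : ℤ)
    · exact ⟨⟨n.toNat, by omega⟩, by simp [h.1]⟩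
    · exact absurd (by simp [timeLimit, h, hφ]) hn

theorem dtft_timeLimit (N : ℕ) (x : ℤ → ℂ) (f : ℝ) :
    dtft (timeLimit N x) f = vecDtft (fun n : Fin N => x ((n : ℕ) : ℤ)) f := by
  unfold dtft vecDtft
  rw [tsum_timeLimit x (fun n z => z * Complex.exp (-(2 * Real.pi * f * n * Complex.I)))
    (fun n => zero_mul _)]
  simp

theorem continuous_vecDtft {N : ℕ} (v : Fin N → ℂ) : Continuous (vecDtft v) := by
  unfold vecDtft
  fun_prop

theorem vecDtft_sum {N : ℕ} {ι : Type*} (t : Finset ι) (c : ι → ℂ) (v : ι → Fin N → ℂ) (f : ℝ) :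
    vecDtft (fun n => ∑ i ∈ t, c i * v i n) f = ∑ i ∈ t, c i * vecDtft (v i) f := by
  simp only [vecDtft, Finset.sum_mul, Finset.mul_sum]
  rw [Finset.sum_comm]
  simp only [mul_assoc]

theorem star_exp_freq (f : ℝ) (n : ℕ) :
    star (Complex.exp (-(2 * Real.pi * f * (n : ℂ) * Complex.I)))
      = Complex.exp (2 * Real.pi * f * (n : ℂ) * Complex.I) := by
  simp [← Complex.exp_conj, map_ofNat]

theorem star_vecDtft {N : ℕ} (w : Fin N → ℂ) (f : ℝ) :
    star (vecDtft w f) =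
      ∑ n : Fin N, Complex.exp (2 * Real.pi * f * ((n : ℕ) : ℂ) * Complex.I) * star (w n) := by
  unfold vecDtft
  rw [star_sum]
  refine Finset.sum_congr rfl fun n _ => ?_
  rw [star_mul, star_exp_freq]

theorem integral_exp_int (d : ℤ) :
    ∫ f in (-(1 / 2 : ℝ))..(1 / 2), Complex.exp (2 * Real.pi * f * (d : ℂ) * Complex.I)
      = if d = 0 then 1 else 0 := by
  split_ifs with h
  · subst h
    simp; norm_num
  · have hc : (2 * Real.pi * (d : ℂ) * Complex.I) ≠ 0 := by
      simp [Real.pi_ne_zero, h]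
    have := integral_exp_mul_complex (a := -(1 / 2 : ℝ)) (b := 1 / 2) hc
    have e : ∀ f : ℝ, Complex.exp (2 * Real.pi * f * (d : ℂ) * Complex.I) =
        Complex.exp (2 * Real.pi * (d : ℂ) * Complex.I * f) := fun f => by ring_nf
    simp_rw [e, this]
    have h1 : Complex.exp (2 * Real.pi * (d : ℂ) * Complex.I * ((1 / 2 : ℝ) : ℂ)) =
        Complex.exp (2 * Real.pi * (d : ℂ) * Complex.I * ((-(1 / 2) : ℝ) : ℂ)) := by
      rw [Complex.exp_eq_exp_iff_exists_int]
      exact ⟨d, by push_cast; ring⟩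
    rw [h1, sub_self, zero_div]

/-- Expanding only the second transform leaves the inverse transform of the first over `[a, b]`,
which is evaluated by the eigenvalue equation on `[-W, W]` and by Fourier inversion on a full
period. -/
theorem integral_vecDtft_mul_star {N : ℕ} (v w : Fin N → ℂ) (a b : ℝ) :
    ∫ f in a..b, vecDtft v f * star (vecDtft w f) =
      ∑ n : Fin N, (∫ f in a..b, vecDtft v f *
        Complex.exp (2 * Real.pi * f * ((n : ℕ) : ℂ) * Complex.I)) * star (w n) := by
  simp_rw [star_vecDtft, Finset.mul_sum]
  rw [intervalIntegral.integral_finsetSum]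
  · refine Finset.sum_congr rfl fun n _ => ?_
    rw [← intervalIntegral.integral_mul_const]
    simp only [mul_assoc]
  · intro n _
    apply Continuous.intervalIntegrable
    have := continuous_vecDtft v
    fun_prop

theorem integral_vecDtft_mul_exp {N : ℕ} (v : Fin N → ℂ) (n : Fin N) :
    ∫ f in (-(1 / 2 : ℝ))..(1 / 2), vecDtft v f *
        Complex.exp (2 * Real.pi * f * ((n : ℕ) : ℂ) * Complex.I) = v n := by
  have e : ∀ f : ℝ, vecDtft v f * Complex.exp (2 * Real.pi * f * ((n : ℕ) : ℂ) * Complex.I) =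
      ∑ m : Fin N, v m * Complex.exp (2 * Real.pi * f *
        (((n : ℕ) - (m : ℕ) : ℤ) : ℂ) * Complex.I) := by
    intro f
    rw [vecDtft, Finset.sum_mul]
    refine Finset.sum_congr rfl fun m _ => ?_
    rw [mul_assoc, ← Complex.exp_add]
    push_cast
    ring_nf
  simp_rw [e]
  rw [intervalIntegral.integral_finsetSum]
  · simp_rw [intervalIntegral.integral_const_mul, integral_exp_int, sub_eq_zero]
    rw [Finset.sum_eq_single n]
    · simp
    · intro m _ hm
      have : ((n : ℕ) : ℤ) ≠ ((m : ℕ) : ℤ) := by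
        intro h; exact hm (Fin.ext (by omega))
      simp [this]
    · simp
  · intro n _
    apply Continuous.intervalIntegrable
    fun_prop

/-- Parseval's identity. -/
theorem parseval_vecDtft {N : ℕ} (v w : Fin N → ℂ) :
    ∫ f in (-(1 / 2 : ℝ))..(1 / 2), vecDtft v f * star (vecDtft w f) = v ⬝ᵥ star w := by
  simp_rw [integral_vecDtft_mul_star, integral_vecDtft_mul_exp]
  rfl

theorem mul_star_self_eq_norm_sq (z : ℂ) : z * star z = ((‖z‖ ^ 2 : ℝ) : ℂ) := by
  simpa using Complex.mul_conj' z

theorem dotProduct_star_self_eq {N : Type*} [Fintype N] (v : N → ℂ) :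
    v ⬝ᵥ star v = ((∑ n, ‖v n‖ ^ 2 : ℝ) : ℂ) := by
  simp only [dotProduct, Pi.star_apply, mul_star_self_eq_norm_sq, Complex.ofReal_sum]

theorem integral_vecDtft_mul_star_self {N : ℕ} (v : Fin N → ℂ) (a b : ℝ) :
    ∫ f in a..b, vecDtft v f * star (vecDtft v f) = ((∫ f in a..b, ‖vecDtft v f‖ ^ 2 : ℝ) : ℂ) := by
  simp_rw [mul_star_self_eq_norm_sq]
  exact intervalIntegral.integral_ofReal

theorem parseval_norm_sq {N : ℕ} (v : Fin N → ℂ) :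
    ∫ f in (-(1 / 2 : ℝ))..(1 / 2), ‖vecDtft v f‖ ^ 2 = ∑ n, ‖v n‖ ^ 2 := by
  have h := parseval_vecDtft v v
  rw [integral_vecDtft_mul_star_self, dotProduct_star_self_eq] at h
  exact_mod_cast h

/-- Cauchy–Schwarz over `N` unimodular terms. It later controls the coefficients of a test vector by
its energy. -/
theorem norm_vecDtft_sq_le {N : ℕ} (v : Fin N → ℂ) (f : ℝ) :
    ‖vecDtft v f‖ ^ 2 ≤ N * ∑ n, ‖v n‖ ^ 2 := by
  have h : ‖vecDtft v f‖ ≤ ∑ n, ‖v n‖ := by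
    refine (norm_sum_le _ _).trans (Finset.sum_le_sum fun n _ => ?_)
    rw [norm_mul, Complex.norm_exp]
    simp
  calc ‖vecDtft v f‖ ^ 2 ≤ (∑ n, ‖v n‖) ^ 2 := by gcongr
    _ ≤ N * ∑ n, ‖v n‖ ^ 2 := by
      simpa using sq_sum_le_card_mul_sum_sq (s := Finset.univ) (f := fun n => ‖v n‖)

/-! ### The DPSS vectors -/

/-- The restriction of the `l`-th DPSS to the index range `{0, …, N-1}`. -/
noncomputable def dpssVec {N : ℕ} (s : Fin N → ℤ → ℝ) (l : Fin N) : Fin N → ℂ :=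
  fun n => ((s l ((n : ℕ) : ℤ) : ℝ) : ℂ)

namespace IsDPSS

variable {N : ℕ} {W : ℝ} {s : Fin N → ℤ → ℝ} {lam : Fin N → ℝ}

theorem integral_band (h : IsDPSS N W s lam) (l : Fin N) (w : Fin N → ℂ) :
    ∫ f in (-W)..W, vecDtft (dpssVec s l) f * star (vecDtft w f) =
      (lam l : ℂ) * (dpssVec s l ⬝ᵥ star w) := by
  rw [integral_vecDtft_mul_star, dotProduct, Finset.mul_sum]
  refine Finset.sum_congr rfl fun n _ => ?_
  have := congrFun (h.eigen l) ((n : ℕ) : ℤ)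
  simp only [bandLimit, dtft_timeLimit, Int.cast_natCast] at this
  rw [show dpssVec s l = fun n : Fin N => ((s l ((n : ℕ) : ℤ) : ℝ) : ℂ) from rfl, this]
  simp [mul_assoc]

theorem norm_sq_eq_one (h : IsDPSS N W s lam) (l : Fin N) : ∑ n, ‖dpssVec s l n‖ ^ 2 = 1 := by
  have := h.normalized l
  rw [signalNorm, Real.sqrt_eq_one,
    tsum_timeLimit (fun n : ℤ => (s l n : ℂ)) (fun _ z => ‖z‖ ^ 2) (by simp)] at this
  exact this

theorem dotProduct_self (h : IsDPSS N W s lam) (l : Fin N) :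
    dpssVec s l ⬝ᵥ star (dpssVec s l) = 1 := by
  rw [dotProduct_star_self_eq, h.norm_sq_eq_one, Complex.ofReal_one]

/-- The band energy form is Hermitian; evaluating it in both orders gives `lam l` and `lam l'` times
the same real inner product, and the eigenvalues differ. -/
theorem dotProduct_ne (h : IsDPSS N W s lam) {l l' : Fin N} (hl : l ≠ l') :
    dpssVec s l ⬝ᵥ star (dpssVec s l') = 0 := by
  have hreal : ∀ l, star (dpssVec s l) = dpssVec s l := fun l => by
    ext n; simp [dpssVec]
  have h1 := h.integral_band l (dpssVec s l')
  have h2 := congrArg star (h.integral_band l' (dpssVec s l))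
  have h3 : star (∫ f in (-W)..W, vecDtft (dpssVec s l') f * star (vecDtft (dpssVec s l) f)) =
      ∫ f in (-W)..W, vecDtft (dpssVec s l) f * star (vecDtft (dpssVec s l') f) := by
    rw [intervalIntegral, intervalIntegral]
    simp only [star_sub, Complex.star_def, ← integral_conj, map_mul, Complex.conj_conj, mul_comm]
  rw [h3, h1, star_mul, hreal, hreal, dotProduct_comm (dpssVec s l')] at h2
  have h4 : star (dpssVec s l ⬝ᵥ dpssVec s l') = dpssVec s l ⬝ᵥ dpssVec s l' := by
    simp [dotProduct, dpssVec]
  have hne : (lam l : ℂ) - lam l' ≠ 0 := by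
    rw [sub_ne_zero]
    intro e
    have e : lam l = lam l' := by exact_mod_cast e
    rcases lt_or_gt_of_ne hl with h' | h'
    · exact (h.lam_strictAnti _ _ h').ne' e
    · exact (h.lam_strictAnti _ _ h').ne e
  rw [h4, Complex.star_def, Complex.conj_ofReal] at h2
  rw [hreal]
  apply mul_left_cancel₀ hne
  rw [mul_zero, sub_mul, h2]
  ring

theorem integral_band_norm_sq (h : IsDPSS N W s lam) (l : Fin N) :
    ∫ f in (-W)..W, ‖vecDtft (dpssVec s l) f‖ ^ 2 = lam l := by
  have := h.integral_band l (dpssVec s l)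
  rw [integral_vecDtft_mul_star_self, h.dotProduct_self, mul_one] at this
  exact_mod_cast this

end IsDPSS

/-! ### Expansion in the DPSS basis and the min-max bound. -/

namespace IsDPSS

variable {N : ℕ} {W : ℝ} {s : Fin N → ℤ → ℝ} {lam : Fin N → ℝ}

theorem sum_dotProduct_mul (h : IsDPSS N W s lam) (y : Fin N → ℂ) (n : Fin N) :
    ∑ j, (y ⬝ᵥ star (dpssVec s j)) * dpssVec s j n = y n := by
  let V : Matrix (Fin N) (Fin N) ℂ := Matrix.of (dpssVec s)
  have hV : V * V.conjTranspose = 1 := by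
    ext i j
    rw [Matrix.one_apply]
    split_ifs with hij
    · subst hij
      exact h.dotProduct_self i
    · exact h.dotProduct_ne hij
  -- `V` is square, so orthonormal rows force `Vᴴ V = 1`, which is completeness.
  have := congrFun (Matrix.vecMul_vecMul y V.conjTranspose V) n
  rw [mul_eq_one_comm.mp hV, Matrix.vecMul_one] at this
  exact this

theorem sum_norm_sq_dotProduct (h : IsDPSS N W s lam) (y : Fin N → ℂ) :
    ∑ j, ‖y ⬝ᵥ star (dpssVec s j)‖ ^ 2 = ∑ n, ‖y n‖ ^ 2 := by
  have e := dotProduct_star_self_eq y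
  have : ((∑ j, ‖y ⬝ᵥ star (dpssVec s j)‖ ^ 2 : ℝ) : ℂ) = y ⬝ᵥ star y := by
    conv_rhs =>
      rw [show y = ∑ j, (y ⬝ᵥ star (dpssVec s j)) • dpssVec s j by
        ext n; simp [h.sum_dotProduct_mul]]
      rw [sum_dotProduct]
    rw [Complex.ofReal_sum]
    refine Finset.sum_congr rfl fun j _ => ?_
    rw [smul_dotProduct, smul_eq_mul, ← mul_star_self_eq_norm_sq]
    congr 1
    rw [← Matrix.dotProduct_star]
    congr 2
    ext n; simp [h.sum_dotProduct_mul]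
  rw [e] at this
  exact_mod_cast this

theorem integral_band_norm_sq_eq_sum (h : IsDPSS N W s lam) (y : Fin N → ℂ) :
    ∫ f in (-W)..W, ‖vecDtft y f‖ ^ 2 = ∑ j, lam j * ‖y ⬝ᵥ star (dpssVec s j)‖ ^ 2 := by
  have hy : ∀ f, vecDtft y f =
      ∑ j, (y ⬝ᵥ star (dpssVec s j)) * vecDtft (dpssVec s j) f := fun f => by
    rw [← vecDtft_sum]
    congr 1
    ext n
    rw [h.sum_dotProduct_mul]
  have e : ∀ f, vecDtft y f * star (vecDtft y f) =
      ∑ j, (y ⬝ᵥ star (dpssVec s j)) * (vecDtft (dpssVec s j) f * star (vecDtft y f)) := fun f => by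
    conv_lhs => enter [1]; rw [hy]
    simp only [Finset.sum_mul, mul_assoc]
  have := integral_vecDtft_mul_star_self y (-W) W
  simp_rw [e] at this
  rw [intervalIntegral.integral_finsetSum] at this
  · simp_rw [intervalIntegral.integral_const_mul, h.integral_band] at this
    rw [← Complex.ofReal_inj, ← this, Complex.ofReal_sum]
    refine Finset.sum_congr rfl fun j _ => ?_
    rw [Complex.ofReal_mul, ← mul_star_self_eq_norm_sq, mul_left_comm]
    congr 2
    exact Matrix.dotProduct_star _ _
  · intro j _
    apply Continuous.intervalIntegrable
    have h1 := continuous_vecDtft y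
    have h2 := continuous_vecDtft (dpssVec s j)
    fun_prop

/-- The Courant–Fischer lower bound for the DPSS eigenvalues. -/
theorem le_lam_of_subspace (h : IsDPSS N W s lam) (l : Fin N) (μ : ℝ)
    (x : Fin ((l : ℕ) + 1) → Fin N → ℂ)
    (hx : ∀ c : Fin ((l : ℕ) + 1) → ℂ, c ≠ 0 → (fun n => ∑ k, c k * x k n) ≠ 0)
    (hμ : ∀ c : Fin ((l : ℕ) + 1) → ℂ,
      μ * ∑ n, ‖∑ k, c k * x k n‖ ^ 2 ≤
        ∫ f in (-W)..W, ‖vecDtft (fun n => ∑ k, c k * x k n) f‖ ^ 2) :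
    μ ≤ lam l := by
  -- Orthogonality to the first `l` DPSS vectors imposes `l` linear conditions on `l + 1`
  -- coefficients, so some nonzero `c` satisfies them. The resulting `y` involves only eigenvalues
  -- `≤ lam l`.
  let T : (Fin ((l : ℕ) + 1) → ℂ) →ₗ[ℂ] (Fin (l : ℕ) → ℂ) :=
    Matrix.mulVecLin (Matrix.of fun (j : Fin (l : ℕ)) k =>
      x k ⬝ᵥ star (dpssVec s ⟨j, j.2.trans l.2⟩))
  obtain ⟨c, hcT, hc⟩ := (Submodule.ne_bot_iff _).mp
    (LinearMap.ker_ne_bot_of_finrank_lt (f := T) (by simp))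
  set y : Fin N → ℂ := fun n => ∑ k, c k * x k n with hy
  have hort : ∀ j : Fin N, j < l → y ⬝ᵥ star (dpssVec s j) = 0 := by
    intro j hj
    have := congrFun (LinearMap.mem_ker.mp hcT) ⟨j, hj⟩
    have hy' : y = ∑ k, c k • x k := by ext n; simp [hy]
    rw [hy', sum_dotProduct]
    simpa [T, Matrix.mulVec, dotProduct, Finset.sum_mul, Finset.mul_sum, mul_assoc, mul_comm,
      mul_left_comm] using this
  have hpos : 0 < ∑ n, ‖y n‖ ^ 2 := by
    obtain ⟨n, hn⟩ := Function.ne_iff.mp (hx c hc)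
    exact Finset.sum_pos' (fun _ _ => by positivity)
      ⟨n, Finset.mem_univ _, by have := norm_pos_iff.mpr hn; positivity⟩
  have hle : ∫ f in (-W)..W, ‖vecDtft y f‖ ^ 2 ≤ lam l * ∑ n, ‖y n‖ ^ 2 := by
    rw [h.integral_band_norm_sq_eq_sum, ← h.sum_norm_sq_dotProduct, Finset.mul_sum]
    refine Finset.sum_le_sum fun j _ => ?_
    rcases lt_trichotomy j l with hj | hj | hj
    · simp [hort j hj]
    · rw [hj]
    · exact mul_le_mul_of_nonneg_right (h.lam_strictAnti _ _ hj).le (by positivity)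
  exact le_of_mul_le_mul_right ((hμ c).trans hle) hpos

end IsDPSS

/-! ### The test filter. -/

theorem vecDtft_modulate {N : ℕ} (v : Fin N → ℂ) (g f : ℝ) :
    vecDtft (fun n => Complex.exp (2 * Real.pi * g * ((n : ℕ) : ℂ) * Complex.I) * v n) f =
      vecDtft v (f - g) := by
  refine Finset.sum_congr rfl fun n _ => ?_
  beta_reduce
  rw [mul_comm (Complex.exp _), mul_assoc, ← Complex.exp_add]
  push_cast
  ring_nf

open Polynomial in
/-- A filter of length `N₁ + m`: the product of the Dirichlet kernel of length `N₁` and a power of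
the two-point averaging filter. -/
theorem exists_kernel {N N₁ m : ℕ} (hN₁ : 0 < N₁) (hN : N₁ + m ≤ N) :
    ∃ g : Fin N → ℂ, vecDtft g 0 = N₁ ∧
      (∀ j : ℤ, j ≠ 0 → |j| < N₁ → vecDtft g (j / N₁) = 0) ∧
      ∀ f : ℝ, ‖vecDtft g f‖ ≤ N₁ * |Real.cos (Real.pi * f)| ^ m := by
  -- The transform is `p` evaluated at `u = e^{-2πif}`. The geometric sum vanishes at the nontrivial
  -- `N₁`-th roots of unity, and `|(1 + u)/2| = |cos πf|`.
  let p : ℂ[X] := (∑ n ∈ Finset.range N₁, X ^ n) * (C (1 / 2) * (1 + X)) ^ m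
  have hdeg : p.natDegree < N := by
    have h1 : (∑ n ∈ Finset.range N₁, (X : ℂ[X]) ^ n).natDegree ≤ N₁ - 1 := by
      refine natDegree_sum_le_of_forall_le _ _ fun n hn => ?_
      rw [natDegree_X_pow]
      have := Finset.mem_range.mp hn
      omega
    have h2 : ((C (1 / 2 : ℂ) * (1 + X)) ^ m).natDegree ≤ m * 1 := by
      refine natDegree_pow_le_of_le _ ?_
      compute_degree
    have := natDegree_mul_le_of_le h1 h2
    change p.natDegree ≤ _ at this
    omega
  have hp : ∀ f : ℝ, vecDtft (fun n : Fin N => p.coeff n) f =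
      p.eval (Complex.exp (-(2 * Real.pi * f * Complex.I))) := by
    intro f
    rw [eval_eq_sum_range' hdeg, ← Fin.sum_univ_eq_sum_range
      (fun n => p.coeff n * Complex.exp (-(2 * Real.pi * f * Complex.I)) ^ n)]
    refine Finset.sum_congr rfl fun n _ => ?_
    rw [← Complex.exp_nat_mul]
    ring_nf
  have hpe : ∀ u : ℂ, p.eval u = (∑ n ∈ Finset.range N₁, u ^ n) * ((1 + u) / 2) ^ m := by
    intro u
    simp only [p, eval_mul, eval_finsetSum, eval_pow, eval_X, eval_C, eval_add, eval_one]
    ring_nf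
  refine ⟨fun n => p.coeff n, ?_, ?_, ?_⟩
  · rw [hp, hpe]
    norm_num
  · intro j hj hjN
    have hN₁' : (N₁ : ℂ) ≠ 0 := by exact_mod_cast hN₁.ne'
    rw [hp, hpe]
    set u := Complex.exp (-(2 * Real.pi * ((j / N₁ : ℝ) : ℂ) * Complex.I)) with hu
    have hu1 : u ≠ 1 := by
      rw [hu, Ne, Complex.exp_eq_one_iff]
      rintro ⟨n, hn⟩
      have h2 : (-(j : ℂ)) = n * N₁ := by
        have : (2 * Real.pi * Complex.I : ℂ) ≠ 0 := by simp [Real.pi_ne_zero]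
        apply mul_right_cancel₀ this
        push_cast at hn
        field_simp at hn
        linear_combination (2 * Real.pi * Complex.I) * hn
      have h3 : -j = n * N₁ := by exact_mod_cast h2
      have h4 : (N₁ : ℤ) ∣ j := ⟨-n, by linarith⟩
      exact hj (Int.eq_zero_of_abs_lt_dvd h4 hjN)
    have huN : u ^ N₁ = 1 := by
      rw [hu, ← Complex.exp_nat_mul, Complex.exp_eq_one_iff]
      refine ⟨-j, ?_⟩
      push_cast
      field_simp
    rw [geom_sum_eq hu1, huN]
    simp
  · intro f
    rw [hp, hpe, norm_mul, norm_pow]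
    set u := Complex.exp (-(2 * Real.pi * f * Complex.I)) with hu
    have hnu : ‖u‖ = 1 := by rw [hu, Complex.norm_exp]; simp
    have h1 : ‖(1 + u) / 2‖ = |Real.cos (Real.pi * f)| := by
      have : (1 + u) / 2 = Complex.exp (-(Real.pi * f * Complex.I)) * (Real.cos (Real.pi * f) : ℂ) := by
        rw [Complex.ofReal_cos, Complex.cos]
        push_cast
        rw [mul_div_assoc', mul_add, ← Complex.exp_add, ← Complex.exp_add, hu]
        ring_nf
        simp
        ring
      rw [this, norm_mul, Complex.norm_exp, Complex.norm_real, Real.norm_eq_abs]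
      simp
    rw [h1]
    gcongr
    refine (norm_sum_le _ _).trans ?_
    simp [hnu]

/-- The function `|cos πt|` decreases with the distance of `t` to the integers. The range extends to
`1 - τ` because differences of two frequencies in `[-1/2, 1/2]` may exceed `1/2`. -/
theorem abs_cos_pi_mul_le {τ t : ℝ} (hτ : 0 ≤ τ) (h1 : τ ≤ |t|) (h2 : |t| ≤ 1 - τ) :
    |Real.cos (Real.pi * t)| ≤ Real.cos (Real.pi * τ) := by
  have hπ := Real.pi_pos
  rw [← Real.cos_abs (Real.pi * t), abs_mul, abs_of_pos hπ, abs_le]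
  constructor
  · rw [← Real.cos_pi_sub]
    refine Real.cos_le_cos_of_nonneg_of_le_pi (by positivity) ?_ ?_
    · nlinarith
    · nlinarith
  · refine Real.cos_le_cos_of_nonneg_of_le_pi (by positivity) ?_ ?_
    · nlinarith
    · nlinarith

/-! ### Exponential clustering of the eigenvalues near one. -/

namespace IsDPSS

variable {N : ℕ} {W : ℝ} {s : Fin N → ℤ → ℝ} {lam : Fin N → ℝ}

/-- A nonasymptotic bound for the clustering of the DPSS eigenvalues near one. -/
theorem one_sub_le_lam (h : IsDPSS N W s lam) {ε : ℝ} (hW : 0 < W) (hW' : W < 1 / 2)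
    (hε : 0 < ε) (hε' : ε < 1) {N₁ m : ℕ} (hN : N₁ + m = N) (hN₁ : (1 - ε / 2) * N ≤ N₁)
    (l : Fin N) (hl : ((l : ℕ) : ℝ) ≤ 2 * N * W * (1 - ε)) :
    1 - N ^ 3 * (Real.cos (Real.pi * (W * ε / 2)) ^ m) ^ 2 ≤ lam l := by
  have hNpos : (0 : ℝ) < N := by exact_mod_cast l.pos
  have hN₁pos : (0 : ℝ) < N₁ := lt_of_lt_of_le (by nlinarith) hN₁
  have hlN₁ : ((l : ℕ) : ℝ) ≤ 2 * N₁ * (W * (1 - ε / 2)) := by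
    -- Uses `1 - ε ≤ (1 - ε/2)²`: one factor pays for shortening `N` to `N₁`, the other for a guard
    -- band of width `W ε / 2`.
    have : N * (1 - ε) ≤ N₁ * (1 - ε / 2) := by
      have h1 := mul_le_mul_of_nonneg_right hN₁ (by linarith : 0 ≤ 1 - ε / 2)
      have h2 : 0 ≤ N * ε ^ 2 := by positivity
      nlinarith
    nlinarith
  have hlN₁' : ((l : ℕ) : ℝ) < N₁ := by
    have : W * (1 - ε / 2) < 1 / 2 := by nlinarith
    nlinarith
  set τ := W * ε / 2 with hτ
  have hτ0 : 0 < τ := by positivity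
  have hτ1 : τ < 1 / 4 := by nlinarith
  set ρ := Real.cos (Real.pi * τ) with hρ
  obtain ⟨g, hg0, hgj, hgb⟩ := exists_kernel (N := N) (N₁ := N₁) (m := m)
    (by exact_mod_cast hN₁pos) hN.le
  -- Frequencies centred at zero with spacing `1 / N₁`, so that their differences are zeros of the
  -- Dirichlet kernel.
  let φ : Fin ((l : ℕ) + 1) → ℝ := fun k => (((k : ℕ) : ℝ) - (l : ℕ) / 2) / N₁
  have hφ : ∀ k, |φ k| ≤ W * (1 - ε / 2) := by
    intro k
    have hk : ((k : ℕ) : ℝ) ≤ (l : ℕ) := by exact_mod_cast Nat.lt_succ_iff.mp k.2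
    have hk0 : (0 : ℝ) ≤ (k : ℕ) := by positivity
    rw [abs_div, abs_of_pos hN₁pos, div_le_iff₀ hN₁pos, abs_le]
    constructor <;> nlinarith
  let x : Fin ((l : ℕ) + 1) → Fin N → ℂ := fun k n =>
    Complex.exp (2 * Real.pi * φ k * ((n : ℕ) : ℂ) * Complex.I) * g n
  have hX : ∀ (c : Fin ((l : ℕ) + 1) → ℂ) (f : ℝ), vecDtft (fun n => ∑ k, c k * x k n) f = ∑ k, c k * vecDtft g (f - φ k) := by
    intro c f
    rw [vecDtft_sum]
    simp only [x, vecDtft_modulate]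
  have hXφ : ∀ (c : Fin ((l : ℕ) + 1) → ℂ) j, vecDtft (fun n => ∑ k, c k * x k n) (φ j) = c j * N₁ := by
    intro c j
    rw [hX, Finset.sum_eq_single j]
    · rw [sub_self, hg0]
    · intro k _ hk
      have e : φ j - φ k = ((((j : ℕ) : ℤ) - ((k : ℕ) : ℤ) : ℤ) : ℝ) / N₁ := by
        simp only [φ]
        push_cast
        ring
      rw [e, hgj, mul_zero]
      · intro h0
        exact hk (Fin.ext (by omega))
      · have : (l : ℕ) < N₁ := by exact_mod_cast hlN₁'
        have hj := j.2
        have hk := k.2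
        rw [abs_lt]
        omega
    · simp
  refine h.le_lam_of_subspace l _ x ?_ ?_
  · intro c hc h0
    obtain ⟨j, hj⟩ := Function.ne_iff.mp hc
    have := hXφ c j
    rw [h0] at this
    simp only [vecDtft, Pi.zero_apply, zero_mul, Finset.sum_const_zero] at this
    rcases mul_eq_zero.mp this.symm with h1 | h1
    · exact hj h1
    · exact hN₁pos.ne' (by exact_mod_cast h1)
  · intro c
    set y : Fin N → ℂ := fun n => ∑ k, c k * x k n with hy
    set E := ∑ n, ‖y n‖ ^ 2 with hE
    have hE0 : 0 ≤ E := Finset.sum_nonneg fun _ _ => by positivity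
    have hρ0 : 0 ≤ ρ := by
      refine Real.cos_nonneg_of_mem_Icc ⟨?_, ?_⟩ <;> nlinarith [Real.pi_pos]
    -- Out of band, `f` stays at distance `≥ τ` from each `φ k` modulo 1. Of the factor `N³`, two
    -- powers come from the `l + 1 ≤ N` terms and one from bounding `‖c k‖ N₁` by `√(N E)`.
    have hbound : ∀ f, W ≤ |f| → |f| ≤ 1 / 2 →
        ‖vecDtft y f‖ ^ 2 ≤ N ^ 3 * (ρ ^ m) ^ 2 * E := by
      intro f hf hf'
      have h1 : ‖vecDtft y f‖ ≤ N * (Real.sqrt (N * E) * ρ ^ m) := by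
        rw [hX]
        refine (norm_sum_le _ _).trans ?_
        calc ∑ k, ‖c k * vecDtft g (f - φ k)‖
            ≤ ∑ _k : Fin ((l : ℕ) + 1), Real.sqrt (N * E) * ρ ^ m := by
              refine Finset.sum_le_sum fun k _ => ?_
              have h2 : ‖c k‖ * N₁ ≤ Real.sqrt (N * E) := by
                refine Real.le_sqrt_of_sq_le ?_
                have := norm_vecDtft_sq_le y (φ k)
                rwa [hXφ, norm_mul, Complex.norm_natCast] at this
              have h3 : |Real.cos (Real.pi * (f - φ k))| ≤ ρ := by
                have h4 := hφ k
                have h5 := abs_sub_abs_le_abs_sub f (φ k)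
                have h6 := abs_sub f (φ k)
                apply abs_cos_pi_mul_le hτ0.le
                · linarith
                · linarith
              calc ‖c k * vecDtft g (f - φ k)‖ = ‖c k‖ * ‖vecDtft g (f - φ k)‖ := norm_mul _ _
                _ ≤ ‖c k‖ * (N₁ * |Real.cos (Real.pi * (f - φ k))| ^ m) := by
                  gcongr
                  exact hgb _
                _ ≤ ‖c k‖ * (N₁ * ρ ^ m) := by gcongr
                _ = ‖c k‖ * N₁ * ρ ^ m := by ring
                _ ≤ _ := by gcongr
          _ = ((l : ℕ) + 1) * (Real.sqrt (N * E) * ρ ^ m) := by simp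
          _ ≤ N * (Real.sqrt (N * E) * ρ ^ m) := by
            gcongr
            exact_mod_cast l.2
      calc ‖vecDtft y f‖ ^ 2 ≤ (N * (Real.sqrt (N * E) * ρ ^ m)) ^ 2 := by gcongr
        _ = N ^ 2 * (Real.sqrt (N * E)) ^ 2 * (ρ ^ m) ^ 2 := by ring
        _ = N ^ 3 * (ρ ^ m) ^ 2 * E := by
          rw [Real.sq_sqrt (by positivity)]
          ring
    have hint : ∀ a b : ℝ,
        IntervalIntegrable (fun f => ‖vecDtft y f‖ ^ 2) MeasureTheory.volume a b := fun a b =>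
      ((continuous_vecDtft y).norm.pow 2).intervalIntegrable a b
    have hL : ∫ f in (-(1 / 2 : ℝ))..(-W), ‖vecDtft y f‖ ^ 2 ≤
        ((-W) - (-(1 / 2 : ℝ))) * (N ^ 3 * (ρ ^ m) ^ 2 * E) := by
      rw [← smul_eq_mul, ← intervalIntegral.integral_const]
      refine intervalIntegral.integral_mono_on (by linarith) (hint _ _) (by simp) fun f hf => ?_
      have : |f| = -f := abs_of_nonpos (by linarith [hf.2])
      exact hbound f (by linarith [hf.2]) (by linarith [hf.1])
    have hR : ∫ f in W..(1 / 2 : ℝ), ‖vecDtft y f‖ ^ 2 ≤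
        (1 / 2 - W) * (N ^ 3 * (ρ ^ m) ^ 2 * E) := by
      rw [← smul_eq_mul, ← intervalIntegral.integral_const]
      refine intervalIntegral.integral_mono_on (by linarith) (hint _ _) (by simp) fun f hf => ?_
      have : |f| = f := abs_of_nonneg (by linarith [hf.1])
      exact hbound f (by linarith [hf.1]) (by linarith [hf.2])
    have htot := parseval_norm_sq y
    rw [← intervalIntegral.integral_add_adjacent_intervals (hint _ (-W)) (hint _ _),
      ← intervalIntegral.integral_add_adjacent_intervals (hint (-W) W) (hint W _)] at htot
    -- The two outer intervals have total length `1 - 2W ≤ 1`.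
    have hB : 0 ≤ N ^ 3 * (ρ ^ m) ^ 2 * E := by positivity
    nlinarith

end IsDPSS

/-- The first DPSS eigenvalues cluster near one exponentially fast, with multiplicative
constant one. -/
theorem exists_clusterNearOne {W ε : ℝ} (hW : 0 < W) (hW' : W < 1 / 2) (hε : 0 < ε)
    (hε' : ε < 1) : ∃ (C₂ : ℝ) (N₀ : ℕ), ClusterNearOne W ε 1 C₂ N₀ := by
  set ρ := Real.cos (Real.pi * (W * ε / 2)) with hρ
  have hτ : 0 < W * ε / 2 := by positivity
  have hτ' : W * ε / 2 < 1 / 4 := by nlinarith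
  have hρ0 : 0 < ρ := Real.cos_pos_of_mem_Ioo ⟨by nlinarith [Real.pi_pos], by nlinarith [Real.pi_pos]⟩
  have hρ1 : ρ < 1 := by
    rw [hρ, ← Real.cos_zero]
    exact Real.cos_lt_cos_of_nonneg_of_le_pi le_rfl (by nlinarith [Real.pi_pos])
      (by nlinarith [Real.pi_pos])
  set a := -Real.log ρ with ha
  have ha0 : 0 < a := neg_pos.mpr (Real.log_neg hρ0 hρ1)
  have hρa : ρ = Real.exp (-a) := by rw [ha, neg_neg, Real.exp_log hρ0]
  -- The available decay is about `e^{-aεN}`. Half of the exponent absorbs `N³` and the rounding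
  -- loss `e^{2a}`; the other half remains as `C₂ = aε/2`, which allows `C₁ = 1`.
  have hlim := tendsto_pow_const_mul_const_pow_of_abs_lt_one 3
    (r := Real.exp (-(a * ε / 2))) (by
      rw [abs_of_pos (Real.exp_pos _), Real.exp_lt_one_iff]
      have : 0 < a * ε / 2 := by positivity
      linarith)
  obtain ⟨N₀, hN₀⟩ := Filter.eventually_atTop.mp
    (hlim.eventually (Iio_mem_nhds (Real.exp_pos (-(2 * a)))))
  refine ⟨a * ε / 2, N₀, one_pos, by positivity, fun N hN s lam h l hl => ?_⟩
  have hceil : ⌈(1 - ε / 2) * (N : ℝ)⌉₊ ≤ N := by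
    rw [Nat.ceil_le]
    nlinarith [Nat.cast_nonneg (α := ℝ) N]
  obtain ⟨m, hm⟩ := Nat.exists_eq_add_of_le hceil
  have hm' : ε * N / 2 - 1 ≤ m := by
    have h1 := Nat.ceil_lt_add_one (a := (1 - ε / 2) * (N : ℝ))
      (mul_nonneg (by linarith) (Nat.cast_nonneg N))
    have h2 : (N : ℝ) = (⌈(1 - ε / 2) * (N : ℝ)⌉₊ : ℝ) + m := by exact_mod_cast hm
    nlinarith
  refine le_trans ?_ (h.one_sub_le_lam hW hW' hε hε' hm.symm (Nat.le_ceil _) l hl)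
  have h3 : (ρ ^ m) ^ 2 ≤ Real.exp (2 * a) * (Real.exp (-(a * ε / 2)) ^ N *
      Real.exp (-(a * ε / 2 * N))) := by
    rw [hρa, ← Real.exp_nat_mul, ← Real.exp_nat_mul, ← Real.exp_nat_mul, ← Real.exp_add,
      ← Real.exp_add, Real.exp_le_exp]
    push_cast
    nlinarith
  have h4 := (hN₀ N hN).le
  have h5 : (N : ℝ) ^ 3 * (ρ ^ m) ^ 2 ≤ Real.exp (-(a * ε / 2 * N)) :=
    calc (N : ℝ) ^ 3 * (ρ ^ m) ^ 2
        ≤ N ^ 3 * (Real.exp (2 * a) * (Real.exp (-(a * ε / 2)) ^ N *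
          Real.exp (-(a * ε / 2 * N)))) := by gcongr
      _ = Real.exp (2 * a) * (N ^ 3 * Real.exp (-(a * ε / 2)) ^ N) *
          Real.exp (-(a * ε / 2 * N)) := by ring
      _ ≤ Real.exp (2 * a) * Real.exp (-(2 * a)) * Real.exp (-(a * ε / 2 * N)) := by gcongr
      _ = Real.exp (-(a * ε / 2 * N)) := by rw [← Real.exp_add]; simp
  linarith

/-! ### Near-orthogonality of signals on disjoint bands. -/

open MeasureTheory in
/-- The Cauchy–Schwarz inequality for continuous functions on a subset of a compact interval. -/
theorem norm_setIntegral_mul_star_le {U V : ℝ → ℂ} (hU : Continuous U) (hV : Continuous V)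
    {S : Set ℝ} {a b : ℝ} (hS : S ⊆ Set.Icc a b) :
    ‖∫ f in S, U f * star (V f)‖ ≤
      Real.sqrt (∫ f in S, ‖U f‖ ^ 2) * Real.sqrt (∫ f in S, ‖V f‖ ^ 2) := by
  have hmem : ∀ {X : ℝ → ℂ}, Continuous X →
      MemLp (fun f => ‖X f‖) (ENNReal.ofReal 2) (volume.restrict S) := by
    intro X hX
    rw [show ENNReal.ofReal 2 = 2 by simp]
    rw [memLp_two_iff_integrable_sq hX.norm.aestronglyMeasurable]
    exact ((hX.norm.pow 2).continuousOn.integrableOn_Icc).mono_set hS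
  have h := integral_mul_le_Lp_mul_Lq_of_nonneg Real.HolderConjugate.two_two
    (μ := volume.restrict S) (f := fun f => ‖U f‖) (g := fun f => ‖V f‖)
    (Filter.Eventually.of_forall fun _ => norm_nonneg _)
    (Filter.Eventually.of_forall fun _ => norm_nonneg _) (hmem hU) (hmem hV)
  simp only [Real.rpow_two, ← Real.sqrt_eq_rpow] at h
  refine (norm_integral_le_integral_norm _).trans ?_
  simpa only [norm_mul, norm_star] using h

open MeasureTheory in
/-- Two signals of unit energy that are concentrated on disjoint bands are almost orthogonal. -/
theorem norm_dotProduct_star_le_of_bands {N : ℕ} {u v : Fin N → ℂ} {a b c d η : ℝ}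
    (hu : ∑ n, ‖u n‖ ^ 2 = 1) (hv : ∑ n, ‖v n‖ ^ 2 = 1) (hab : a ≤ b) (hcd : c ≤ d)
    (ha : -(1 / 2) ≤ a) (hb : b ≤ 1 / 2) (hc : -(1 / 2) ≤ c) (hd : d ≤ 1 / 2)
    (hdisj : b ≤ c ∨ d ≤ a)
    (hub : 1 - η ≤ ∫ f in a..b, ‖vecDtft u f‖ ^ 2) (hvb : 1 - η ≤ ∫ f in c..d, ‖vecDtft v f‖ ^ 2) :
    ‖u ⬝ᵥ star v‖ ≤ 2 * Real.sqrt η := by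
  have hU := continuous_vecDtft u
  have hV := continuous_vecDtft v
  have hhalf : (-(1 / 2 : ℝ)) ≤ 1 / 2 := by norm_num
  have hEI : Set.Ioc c d ⊆ Set.Ioc (-(1 / 2 : ℝ)) (1 / 2) := Set.Ioc_subset_Ioc hc hd
  have hDI : Set.Ioc a b ⊆ Set.Ioc (-(1 / 2 : ℝ)) (1 / 2) := Set.Ioc_subset_Ioc ha hb
  have hED : Set.Ioc c d ⊆ Set.Ioc (-(1 / 2 : ℝ)) (1 / 2) \ Set.Ioc a b := by
    intro f hf
    refine ⟨hEI hf, fun hf' => ?_⟩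
    rcases hdisj with h | h
    · linarith [hf.1, hf'.2]
    · linarith [hf.2, hf'.1]
  have hInt : ∀ {X : ℝ → ℂ}, Continuous X → ∀ {S : Set ℝ},
      S ⊆ Set.Ioc (-(1 / 2 : ℝ)) (1 / 2) → IntegrableOn (fun f => ‖X f‖ ^ 2) S := by
    intro X hX S hS
    exact ((hX.norm.pow 2).continuousOn.integrableOn_Icc).mono_set
      (hS.trans Set.Ioc_subset_Icc_self)
  have hmono : ∀ {X : ℝ → ℂ}, Continuous X → ∀ {S T : Set ℝ}, S ⊆ T →
      T ⊆ Set.Ioc (-(1 / 2 : ℝ)) (1 / 2) → ∫ f in S, ‖X f‖ ^ 2 ≤ ∫ f in T, ‖X f‖ ^ 2 := by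
    intro X hX S T hST hT
    exact setIntegral_mono_set (hInt hX hT) (Filter.Eventually.of_forall fun _ => by positivity)
      hST.eventuallyLE
  rw [intervalIntegral.integral_of_le hab] at hub
  rw [intervalIntegral.integral_of_le hcd] at hvb
  have hut := parseval_norm_sq u
  have hvt := parseval_norm_sq v
  rw [intervalIntegral.integral_of_le hhalf, hu] at hut
  rw [intervalIntegral.integral_of_le hhalf, hv] at hvt
  have hu' : ∫ f in Set.Ioc c d, ‖vecDtft u f‖ ^ 2 ≤ η := by
    refine (hmono hU hED Set.sdiff_subset).trans ?_
    rw [setIntegral_sdiff measurableSet_Ioc (hInt hU subset_rfl) hDI]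
    linarith
  have hv' : ∫ f in Set.Ioc (-(1 / 2 : ℝ)) (1 / 2) \ Set.Ioc c d, ‖vecDtft v f‖ ^ 2 ≤ η := by
    rw [setIntegral_sdiff measurableSet_Ioc (hInt hV subset_rfl) hEI]
    linarith
  have hu1 := hmono hU (Set.sdiff_subset (t := Set.Ioc c d)) subset_rfl
  have hv1 := hmono hV hEI subset_rfl
  rw [hut] at hu1
  rw [hvt] at hv1
  have hprod : IntegrableOn (fun f => vecDtft u f * star (vecDtft v f))
      (Set.Ioc (-(1 / 2 : ℝ)) (1 / 2)) :=
    ((hU.mul hV.star).continuousOn.integrableOn_Icc).mono_set Set.Ioc_subset_Icc_self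
  -- Split the period at `(c, d]`: there `u` has energy at most `η`, and on the complement `v` does.
  -- Each piece contributes at most `√η`.
  rw [← parseval_vecDtft, intervalIntegral.integral_of_le hhalf,
    ← integral_inter_add_sdiff measurableSet_Ioc hprod (t := Set.Ioc c d),
    Set.inter_eq_right.mpr hEI]
  refine (norm_add_le _ _).trans ?_
  have h1 := norm_setIntegral_mul_star_le hU hV (hEI.trans Set.Ioc_subset_Icc_self)
  have h2 := norm_setIntegral_mul_star_le hU hV
    ((Set.sdiff_subset (t := Set.Ioc c d)).trans
      (Set.Ioc_subset_Icc_self (a := -(1 / 2 : ℝ)) (b := 1 / 2)))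
  have h3 := mul_le_mul (Real.sqrt_le_sqrt hu') (Real.sqrt_le_one.mpr hv1)
    (Real.sqrt_nonneg _) (Real.sqrt_nonneg _)
  have h4 := mul_le_mul (Real.sqrt_le_one.mpr hu1) (Real.sqrt_le_sqrt hv')
    (Real.sqrt_nonneg _) zero_le_one
  linarith

/-! ### Dictionaries with small coherence -/

theorem l2norm_sq {ι : Type*} [Fintype ι] (v : ι → ℂ) : l2norm v ^ 2 = ∑ i, ‖v i‖ ^ 2 := by
  rw [l2norm, EuclideanSpace.norm_sq_eq]

theorem sqrt_mul_l2norm {ι : Type*} [Fintype ι] (x : ℝ) (v : ι → ℂ) :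
    Real.sqrt x * l2norm v = Real.sqrt (x * l2norm v ^ 2) := by
  have : 0 ≤ l2norm v := norm_nonneg _
  rw [Real.sqrt_mul' _ (sq_nonneg _), Real.sqrt_sq this]

/-- A matrix with unit columns and small coherence is almost an isometry. -/
theorem abs_l2norm_mulVec_sq_sub_le {m ι : Type*} [Fintype m] [Fintype ι]
    (Ψ : Matrix m ι ℂ) {μ : ℝ} (hμ : 0 ≤ μ) (h1 : ∀ p, Ψ.col p ⬝ᵥ star (Ψ.col p) = 1)
    (h2 : ∀ p q, p ≠ q → ‖Ψ.col p ⬝ᵥ star (Ψ.col q)‖ ≤ μ) (α : ι → ℂ) :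
    |l2norm (Ψ.mulVec α) ^ 2 - l2norm α ^ 2| ≤ Fintype.card ι * μ * l2norm α ^ 2 := by
  classical
  have e1 : ((l2norm (Ψ.mulVec α) ^ 2 : ℝ) : ℂ) =
      ∑ p, ∑ q, α p * star (α q) * (Ψ.col p ⬝ᵥ star (Ψ.col q)) := by
    rw [l2norm_sq, ← dotProduct_star_self_eq]
    simp only [Matrix.mulVec_eq_sum, star_sum, sum_dotProduct, dotProduct_sum]
    rw [Finset.sum_comm]
    simp [mul_assoc, mul_left_comm, Matrix.col]
  have e2 : ((l2norm α ^ 2 : ℝ) : ℂ) =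
      ∑ p, ∑ q, if p = q then α p * star (α q) else 0 := by
    rw [l2norm_sq, ← dotProduct_star_self_eq]
    simp [dotProduct]
  have e3 : ‖((l2norm (Ψ.mulVec α) ^ 2 - l2norm α ^ 2 : ℝ) : ℂ)‖ ≤
      ∑ p, ∑ q, ‖α p‖ * ‖α q‖ * μ := by
    rw [Complex.ofReal_sub, e1, e2, ← Finset.sum_sub_distrib]
    refine (norm_sum_le _ _).trans (Finset.sum_le_sum fun p _ => ?_)
    rw [← Finset.sum_sub_distrib]
    refine (norm_sum_le _ _).trans (Finset.sum_le_sum fun q _ => ?_)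
    by_cases hpq : p = q
    · subst hpq
      rw [h1]
      simp only [mul_one, if_true, sub_self, norm_zero]
      positivity
    · rw [if_neg hpq, sub_zero, norm_mul, norm_mul, norm_star]
      gcongr
      exact h2 p q hpq
  rw [Complex.norm_real, Real.norm_eq_abs] at e3
  refine e3.trans ?_
  have e4 : ∑ p, ∑ q, ‖α p‖ * ‖α q‖ * μ = (∑ p, ‖α p‖) ^ 2 * μ := by
    rw [sq, Finset.sum_mul_sum, Finset.sum_mul]
    simp only [Finset.sum_mul]
  -- The number of columns enters here, by Cauchy–Schwarz.
  have e5 : (∑ p, ‖α p‖) ^ 2 ≤ Fintype.card ι * l2norm α ^ 2 := by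
    rw [l2norm_sq]
    exact sq_sum_le_card_mul_sum_sq (s := Finset.univ) (f := fun p => ‖α p‖)
  rw [e4]
  nlinarith

/-- After squaring, `(1 - δ)(1 - κ) ≥ 1 - δ - κ` and, since `δ < 1`, `(1 + δ)(1 + κ) ≤ 1 + δ + 2κ`.
The class `P` is arbitrary, which covers sparse and block-sparse vectors together. -/
theorem DictIsometryBounds.isometryBounds {m n ι : Type*} [Fintype m] [Fintype n] [Fintype ι]
    {P : (ι → ℂ) → Prop} {Ψ : Matrix n ι ℂ} {A : Matrix m n ℂ} {δ δ' κ : ℝ}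
    (h : DictIsometryBounds P Ψ A δ) (hδ : 0 < δ) (hδ1 : δ < 1) (hκ : 0 ≤ κ)
    (hΨ : ∀ α, |l2norm (Ψ.mulVec α) ^ 2 - l2norm α ^ 2| ≤ κ * l2norm α ^ 2)
    (hδ' : δ + 2 * κ ≤ δ') : IsometryBounds P (A * Ψ) δ' := by
  intro α hα
  obtain ⟨h1, h2⟩ := h α hα
  obtain ⟨h3, h4⟩ := abs_le.mp (hΨ α)
  have ha := sq_nonneg (l2norm α)
  have hmul : (δ + 2 * κ) * l2norm α ^ 2 ≤ δ' * l2norm α ^ 2 :=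
    mul_le_mul_of_nonneg_right hδ' ha
  have hκa : 0 ≤ κ * l2norm α ^ 2 := mul_nonneg hκ ha
  refine ⟨le_trans ?_ h1, h2.trans ?_⟩
  · rw [sqrt_mul_l2norm, sqrt_mul_l2norm]
    apply Real.sqrt_le_sqrt
    nlinarith
  · rw [sqrt_mul_l2norm, sqrt_mul_l2norm]
    apply Real.sqrt_le_sqrt
    nlinarith

/-! ### The multiband dictionary -/

theorem dpssDictionary_col {N k : ℕ} (hk : k ≤ N) (Bnyq Bband Ts : ℝ) (J : ℕ)
    (s : Fin N → ℤ → ℝ) (p : Fin J × Fin k) :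
    (dpssDictionary hk Bnyq Bband Ts J s).col p = fun n : Fin N =>
      Complex.exp (2 * Real.pi * (bandCenter Bnyq Bband (p.1 : ℕ) * Ts : ℝ) * ((n : ℕ) : ℂ) *
        Complex.I) * dpssVec s (Fin.castLE hk p.2) n := by
  ext n
  simp [dpssDictionary, dpssBlock, modulator, dpssMatrix, dpssVec, Matrix.col,
    Matrix.diagonal_mul]

theorem modulate_dotProduct_star {N : ℕ} (v w : Fin N → ℂ) (g : ℝ) :
    (fun n : Fin N => Complex.exp (2 * Real.pi * g * ((n : ℕ) : ℂ) * Complex.I) * v n) ⬝ᵥ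
      star (fun n : Fin N => Complex.exp (2 * Real.pi * g * ((n : ℕ) : ℂ) * Complex.I) * w n) =
      v ⬝ᵥ star w := by
  refine Finset.sum_congr rfl fun n _ => ?_
  simp only [Pi.star_apply, star_mul]
  have h := mul_star_self_eq_norm_sq (Complex.exp (2 * Real.pi * g * ((n : ℕ) : ℂ) * Complex.I))
  rw [Complex.norm_exp] at h
  simp only [Complex.mul_re, Complex.mul_im, Complex.I_re, Complex.I_im, Complex.re_ofNat,
    Complex.im_ofNat, Complex.ofReal_re, Complex.ofReal_im, Complex.natCast_re,
    Complex.natCast_im] at h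
  norm_num at h
  simp only [Complex.star_def]
  linear_combination (v n * (starRingEnd ℂ) (w n)) * h

theorem sum_norm_sq_modulate {N : ℕ} (v : Fin N → ℂ) (g : ℝ) :
    ∑ n : Fin N, ‖Complex.exp (2 * Real.pi * g * ((n : ℕ) : ℂ) * Complex.I) * v n‖ ^ 2 =
      ∑ n, ‖v n‖ ^ 2 := by
  have h := modulate_dotProduct_star v v g
  rw [dotProduct_star_self_eq, dotProduct_star_self_eq] at h
  exact_mod_cast h

theorem IsDPSS.integral_modulate_norm_sq {N : ℕ} {W : ℝ} {s : Fin N → ℤ → ℝ} {lam : Fin N → ℝ}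
    (h : IsDPSS N W s lam) (l : Fin N) (g : ℝ) :
    ∫ f in (g - W)..(g + W), ‖vecDtft (fun n : Fin N =>
      Complex.exp (2 * Real.pi * g * ((n : ℕ) : ℂ) * Complex.I) * dpssVec s l n) f‖ ^ 2 =
      lam l := by
  simp only [vecDtft_modulate]
  rw [intervalIntegral.integral_comp_sub_right (fun f => ‖vecDtft (dpssVec s l) f‖ ^ 2) g,
    ← h.integral_band_norm_sq l]
  congr 1 <;> ring

/-- The multiband modulated DPSS dictionary is almost an isometry. -/
theorem IsDPSS.abs_l2norm_dpssDictionary_mulVec_sq_sub_le {N : ℕ} {W : ℝ} {s : Fin N → ℤ → ℝ}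
    {lam : Fin N → ℝ} (h : IsDPSS N W s lam) {Bnyq Bband Ts η : ℝ} {J k : ℕ} (hk : k ≤ N)
    (hband : 0 < Bband) (hJ : Bnyq = J * Bband) (hTs : 0 < Ts) (hnyq : Bnyq * Ts ≤ 1)
    (hW : W = Bband * Ts / 2) (hJk : J * k ≤ N)
    (hlam : ∀ l : Fin k, 1 - η ≤ lam (Fin.castLE hk l)) (α : Fin J × Fin k → ℂ) :
    |l2norm ((dpssDictionary hk Bnyq Bband Ts J s).mulVec α) ^ 2 - l2norm α ^ 2| ≤
      2 * N * Real.sqrt η * l2norm α ^ 2 := by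
  have hBT : 0 < Bband * Ts := mul_pos hband hTs
  -- The bands tile an interval of length `J * Bband * Ts = Bnyq * Ts ≤ 1` centred at zero, so none
  -- of them wraps around the period.
  have hcenter : ∀ i : ℕ, bandCenter Bnyq Bband i * Ts - W = (i - J / 2) * (Bband * Ts) ∧
      bandCenter Bnyq Bband i * Ts + W = (i + 1 - J / 2) * (Bband * Ts) := by
    intro i
    rw [bandCenter, hW, hJ]
    constructor <;> ring
  have hlow : ∀ i : ℕ, -(1 / 2) ≤ bandCenter Bnyq Bband i * Ts - W := by
    intro i
    rw [(hcenter i).1]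
    have : 0 ≤ (i : ℝ) * (Bband * Ts) := by positivity
    rw [hJ] at hnyq
    nlinarith
  have hhigh : ∀ i : Fin J, bandCenter Bnyq Bband (i : ℕ) * Ts + W ≤ 1 / 2 := by
    intro i
    rw [(hcenter i).2]
    have hi : ((i : ℕ) : ℝ) + 1 ≤ J := by exact_mod_cast i.2
    have := mul_le_mul_of_nonneg_right hi hBT.le
    rw [hJ] at hnyq
    nlinarith
  have hsep : ∀ i j : ℕ, i < j →
      bandCenter Bnyq Bband i * Ts + W ≤ bandCenter Bnyq Bband j * Ts - W := by
    intro i j hij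
    rw [(hcenter i).2, (hcenter j).1]
    have hij : (i : ℝ) + 1 ≤ j := by exact_mod_cast hij
    exact mul_le_mul_of_nonneg_right (by linarith) hBT.le
  have hcard : (Fintype.card (Fin J × Fin k) : ℝ) ≤ N := by
    simp only [Fintype.card_prod, Fintype.card_fin]
    exact_mod_cast hJk
  refine (abs_l2norm_mulVec_sq_sub_le _ (μ := 2 * Real.sqrt η) (by positivity) ?_ ?_ α).trans ?_
  · intro p
    rw [dpssDictionary_col, modulate_dotProduct_star, h.dotProduct_self]
  · intro p q hpq
    rw [dpssDictionary_col, dpssDictionary_col]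
    by_cases h1 : p.1 = q.1
    · have h2 : Fin.castLE hk p.2 ≠ Fin.castLE hk q.2 := fun e =>
        hpq (Prod.ext h1 (Fin.castLE_injective hk e))
      rw [h1, modulate_dotProduct_star, h.dotProduct_ne h2, norm_zero]
      positivity
    · refine norm_dotProduct_star_le_of_bands
        (a := bandCenter Bnyq Bband p.1 * Ts - W) (b := bandCenter Bnyq Bband p.1 * Ts + W)
        (c := bandCenter Bnyq Bband q.1 * Ts - W) (d := bandCenter Bnyq Bband q.1 * Ts + W)
        ?_ ?_ (by linarith) (by linarith) (hlow _) (hhigh _) (hlow _) (hhigh _) ?_ ?_ ?_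
      · rw [sum_norm_sq_modulate, h.norm_sq_eq_one]
      · rw [sum_norm_sq_modulate, h.norm_sq_eq_one]
      · rcases lt_or_gt_of_ne h1 with h2 | h2
        · exact Or.inl (hsep _ _ h2)
        · exact Or.inr (hsep _ _ h2)
      · rw [h.integral_modulate_norm_sq]
        exact hlam _
      · rw [h.integral_modulate_norm_sq]
        exact hlam _
  · have ha := sq_nonneg (l2norm α)
    calc _ ≤ N * (2 * Real.sqrt η) * l2norm α ^ 2 := by gcongr
      _ = _ := by ring

/-- First part: the constants exist, with `C₁` absolute. Second part: for all such constants, the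
two implications hold. The constant `δ'` of the conclusion may exceed `1`; the two-sided bounds are
claimed in any case, and they are the RIP (block-RIP) as soon as `δ' < 1`. -/
theorem mainTheorem8 :
    (∃ C₁ : ℝ, 0 < C₁ ∧ ∀ W ε : ℝ, 0 < W → W < 1 / 2 → 0 < ε → ε < 1 →
      ∃ (C₂ : ℝ) (N₀ : ℕ), ClusterNearOne W ε C₁ C₂ N₀) ∧
    (∀ (Bnyq Bband Ts W ε C₁ C₂ : ℝ) (N₀ J N k M : ℕ),
      0 < Bnyq → 0 < Bband → (J : ℝ) = Bnyq / Bband →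
      0 < Ts → Ts ≤ 1 / Bnyq →
      W = Bband * Ts / 2 → W < 1 / 2 →
      0 < ε → ε < 1 →
      ClusterNearOne W ε C₁ C₂ N₀ → N₀ ≤ N →
      (k : ℝ) = 2 * N * W * (1 - ε) →
      ∀ (hk : k ≤ N) (s : Fin N → ℤ → ℝ) (lam : Fin N → ℝ), IsDPSS N W s lam →
      ∀ (A : Matrix (Fin M) (Fin N) ℂ) (δ δ' : ℝ),
        δ' = δ + 6 * N * C₁ ^ (1 / 2 : ℝ) * Real.exp (-(C₂ * N) / 2) →
        (∀ S : ℕ, DictRIP (dpssDictionary hk Bnyq Bband Ts J s) A S δ →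
          IsometryBounds (IsSparse S) (A * dpssDictionary hk Bnyq Bband Ts J s) δ' ∧
          (δ' < 1 → RIP (A * dpssDictionary hk Bnyq Bband Ts J s) S δ')) ∧
        (∀ K : ℕ, DictBlockRIP (dpssDictionary hk Bnyq Bband Ts J s) A K δ →
          IsometryBounds (IsBlockSparse K) (A * dpssDictionary hk Bnyq Bband Ts J s) δ' ∧
          (δ' < 1 → BlockRIP (A * dpssDictionary hk Bnyq Bband Ts J s) K δ'))) := by
  refine ⟨⟨1, one_pos, fun W ε hW hW' hε hε' => exists_clusterNearOne hW hW' hε hε'⟩, ?_⟩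
  intro Bnyq Bband Ts W ε C₁ C₂ N₀ J N k M hnyq hband hJ hTs hTs' hW hW' hε hε' hC hN hk' hk s lam
    h A δ δ' hδ'
  obtain ⟨hC₁, -, hC⟩ := hC
  have hJ' : Bnyq = J * Bband := by rw [hJ]; field_simp
  have hnyqTs : Bnyq * Ts ≤ 1 := by
    rwa [le_div_iff₀ hnyq, mul_comm] at hTs'
  have hNonneg : (0 : ℝ) ≤ N := Nat.cast_nonneg N
  have hJk : J * k ≤ N := by
    have e : (J : ℝ) * k = N * (Bnyq * Ts) * (1 - ε) := by
      rw [hk', hW, hJ']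
      ring
    have h0 : 0 ≤ Bnyq * Ts := by positivity
    have h1 : (N : ℝ) * (Bnyq * Ts) ≤ N := mul_le_of_le_one_right hNonneg hnyqTs
    have h2 : 0 ≤ (N : ℝ) * (Bnyq * Ts) := by positivity
    have : (J : ℝ) * k ≤ N := by nlinarith
    exact_mod_cast this
  set η := C₁ * Real.exp (-(C₂ * N)) with hη
  have hsqrt : Real.sqrt η = C₁ ^ (1 / 2 : ℝ) * Real.exp (-(C₂ * N) / 2) := by
    rw [hη, Real.sqrt_mul hC₁.le, Real.sqrt_eq_rpow C₁, Real.exp_half]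
  have hΨ := h.abs_l2norm_dpssDictionary_mulVec_sq_sub_le hk hband hJ' hTs hnyqTs hW hJk
    (fun l => hC N hN s lam h _ (by
      rw [← hk']
      exact_mod_cast l.2.le))
  have hκ : 0 ≤ 2 * N * Real.sqrt η := by positivity
  -- The argument needs only `4N√η`; the stated `6N√η` leaves slack.
  have hle : δ + 2 * (2 * N * Real.sqrt η) ≤ δ' := by
    have : δ' = δ + 6 * N * Real.sqrt η := by
      rw [hδ', hsqrt]
      ring
    rw [this]
    linarith
  refine ⟨fun S hS => ?_, fun K hK => ?_⟩
  · have := hS.2.2.isometryBounds hS.1 hS.2.1 hκ hΨ hle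
    exact ⟨this, fun h1 => ⟨by linarith [hS.1], h1, this⟩⟩
  · have := hK.2.2.isometryBounds hK.1 hK.2.1 hκ hΨ hle
    exact ⟨this, fun h1 => ⟨by linarith [hK.1], h1, this⟩⟩
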